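/- Let $d\ge 1$ and $N\ge 1$ be integers. Let $L_N(\mathbf{R}^d)$ be the class of differentiable functions $f:\mathbf{R}^d\to\mathbf{R}$ for which there are constants $C>0$ and $0\le\epsilon<1$ such that 1. $|f(x)|\le C(1+|x|)^{-d-N+\epsilon}$ for all $x\in\mathbf{R}^d$; 2. $|\partial_k f(x)|\le C(1+|x|)^{-d-N-1+\epsilon}$ for all $x\in\mathbf{R}^d$ and $1\le k\le d$; 3. $\int_{\mathbf{R}^d}x^{\beta}f(x)\,dx=0$ for every multi-index $\beta$ with $|\beta|=\beta_1+\dots+\beta_d<N$. For $1\le i\le d$ let $$\mathcal{R}_if(x)=C_d\lim_{\eta\to0^+}\int_{|x-y|>\eta}f(y)\,\frac{x_i-y_i}{|x-y|^{d+1}}\,dy,\qquad C_d=\frac{\Gamma\left(\frac{d+1}{2}\right)}{\pi^{(d+1)/2}},$$ be the $i$-th component of the Riesz transform of $f$, where $|\cdot|$ is the Euclidean norm. **Theorem.** If $f\in L_N(\mathbf{R}^d)$ and $1\le i\le d$, then $\mathcal{R}_if(x)$ is well defined for every $x\in\mathbf{R}^d$ (the truncated integrals converge absolutely and the limit exists),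 and $\mathcal{R}_if$ has vanishing moments up to degree $N-1$: for every multi-index $\beta$ with $|\beta|<N$, the function $x\mapsto x^{\beta}\,\mathcal{R}_if(x)$ is integrable on $\mathbf{R}^d$ and $$\int_{\mathbf{R}^d}x^{\beta}\,\mathcal{R}_if(x)\,dx=0.$$ -/

import Mathlib

open MeasureTheory Filter Topology

noncomputable section

/-- The monomial `x ^ β = x₁ ^ β₁ ⋯ x_d ^ β_d`. -/
def monomialFn {d : ℕ} (β : Fin d → ℕ) (x : EuclideanSpace ℝ (Fin d)) : ℝ :=
  ∏ k, x k ^ β k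

/-- The class `L_N(ℝ^d)`: differentiable real functions with decay of the function and of its
first order partial derivatives, and with vanishing moments of every order `|β| < N`.
(The decay makes the moment integrals absolutely convergent.) -/
structure MemL {d : ℕ} (N : ℕ) (f : EuclideanSpace ℝ (Fin d) → ℝ) : Prop where
  differentiable : Differentiable ℝ f
  decay : ∃ C ε : ℝ, 0 < C ∧ 0 ≤ ε ∧ ε < 1 ∧
    (∀ x, |f x| ≤ C * (1 + ‖x‖) ^ (-(d : ℝ) - N + ε)) ∧
    (∀ (k : Fin d) (x), |fderiv ℝ f x (EuclideanSpace.single k 1)| ≤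
      C * (1 + ‖x‖) ^ (-(d : ℝ) - N - 1 + ε))
  moments : ∀ β : Fin d → ℕ, ∑ k, β k < N → ∫ x, monomialFn β x * f x = 0

/-- All moments of order `|β| < N` (that is, up to degree `N - 1`) converge absolutely and
vanish. -/
def HasVanishingMoments {d : ℕ} (N : ℕ) (g : EuclideanSpace ℝ (Fin d) → ℝ) : Prop :=
  ∀ β : Fin d → ℕ, ∑ k, β k < N →
    Integrable (fun x => monomialFn β x * g x) ∧ ∫ x, monomialFn β x * g x = 0

/-- The Riesz kernel `y_i / |y| ^ (d + 1)`. -/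
def rieszKernel {d : ℕ} (i : Fin d) (y : EuclideanSpace ℝ (Fin d)) : ℝ :=
  y i / ‖y‖ ^ (d + 1)

/-- The normalizing constant `C_d = Γ((d + 1) / 2) / π ^ ((d + 1) / 2)`, for which the `i`-th
Riesz transform has the Fourier multiplier `-j ω_i / |ω|`. -/
def rieszConst (d : ℕ) : ℝ :=
  Real.Gamma (((d : ℝ) + 1) / 2) / Real.pi ^ (((d : ℝ) + 1) / 2)

/-- The normalized integral over `|x - y| > ε`. -/
def truncatedRiesz {d : ℕ} (i : Fin d) (f : EuclideanSpace ℝ (Fin d) → ℝ) (ε : ℝ)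
    (x : EuclideanSpace ℝ (Fin d)) : ℝ :=
  rieszConst d * ∫ y in {y | ε < ‖x - y‖}, f y * rieszKernel i (x - y)

/-- The `i`-th component of the Riesz transform, as a principal value. -/
def rieszTransform {d : ℕ} (i : Fin d) (f : EuclideanSpace ℝ (Fin d) → ℝ)
    (x : EuclideanSpace ℝ (Fin d)) : ℝ :=
  limUnder (𝓝[>] (0 : ℝ)) (fun ε => truncatedRiesz i f ε x)

/-- The principal value integral defining the `i`-th Riesz transform of `f` at `x` exists: the
truncated integrals converge absolutely, and they have a limit as the truncation tends to `0`. -/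
def RieszTransformExistsAt {d : ℕ} (i : Fin d) (f : EuclideanSpace ℝ (Fin d) → ℝ)
    (x : EuclideanSpace ℝ (Fin d)) : Prop :=
  (∀ ε : ℝ, 0 < ε → IntegrableOn (fun y => f y * rieszKernel i (x - y)) {y | ε < ‖x - y‖}) ∧
    ∃ l : ℝ, Tendsto (fun ε => truncatedRiesz i f ε x) (𝓝[>] (0 : ℝ)) (𝓝 l)

end

/-!
The Riesz kernel `K` is split by a radial smooth cutoff into a near part, supported in the ball of
radius `2`, and a far part, which is smooth. Since `K` is odd, the principal value is the absolutely
convergent integral `∫ K(z) (f (x - z) - f (x + z)) dz / 2` (`MemL.rieszTransform_eq`), and the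
Riesz transform splits accordingly.

The near part has vanishing moments by Fubini, because vanishing moments are invariant under
translation (`MemL.integral_monomialFn_mul_near`); the decay of the gradient of `f` provides the
integrability.

For the far part, `f` annihilates the Taylor polynomial of degree less than `N` of
`y ↦ farKernel i (x - y)`, so the kernel may be replaced by its Taylor error. Integrating the error
in `x` bounds the moment of order `|β| ≤ N - 1` by
`M * ∫ ‖y‖ ^ (N - 1 + δ) * |f y|`, with `M` independent of `f` and some `δ > 0` for which the
integral is finite (`MemL.exists_integral_rieszTransform_le`).

This bound also makes the moments vanish. The Riesz transform commutes with dilations; applied to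
`x ↦ f (R • x)`, the bound has a left side that scales as `R ^ (-d - |β|)` and a right side that
scales as `R ^ (-d - (N - 1) - δ)`. As `|β| ≤ N - 1`, letting `R → ∞` gives the claim.
-/

/-! ### The Riesz kernel and its smooth cutoff -/

theorem rieszKernel_neg {d : ℕ} (i : Fin d) (z : EuclideanSpace ℝ (Fin d)) :
    rieszKernel i (-z) = -rieszKernel i z := by
  simp [rieszKernel, neg_div]

theorem abs_rieszKernel_le {d : ℕ} (i : Fin d) (z : EuclideanSpace ℝ (Fin d)) :
    |rieszKernel i z| ≤ (‖z‖ ^ d)⁻¹ := by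
  rcases eq_or_ne z 0 with rfl | hz
  · simp [rieszKernel]
  have hz' : 0 < ‖z‖ := norm_pos_iff.2 hz
  have h1 : |z i| ≤ ‖z‖ := by simpa using PiLp.norm_apply_le z i
  rw [rieszKernel, abs_div, abs_of_nonneg (by positivity : (0 : ℝ) ≤ ‖z‖ ^ (d + 1)), pow_succ,
    div_le_iff₀ (by positivity)]
  field_simp
  exact h1

theorem rieszKernel_smul {d : ℕ} (i : Fin d) {a : ℝ} (ha : 0 < a)
    (z : EuclideanSpace ℝ (Fin d)) : rieszKernel i (a • z) = (a ^ d)⁻¹ * rieszKernel i z := by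
  simp only [rieszKernel, PiLp.smul_apply, smul_eq_mul, norm_smul, Real.norm_eq_abs,
    abs_of_pos ha, mul_pow, pow_succ]
  rcases eq_or_ne z 0 with rfl | hz
  · simp
  have hz' : 0 < ‖z‖ := norm_pos_iff.2 hz
  field_simp

theorem measurable_rieszKernel {d : ℕ} (i : Fin d) : Measurable (rieszKernel i) := by
  unfold rieszKernel
  fun_prop

theorem contDiffAt_rieszKernel {d : ℕ} (i : Fin d) {z : EuclideanSpace ℝ (Fin d)} (hz : z ≠ 0)
    (n : ℕ) : ContDiffAt ℝ n (rieszKernel i) z := by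
  unfold rieszKernel
  refine ContDiffAt.div ?_ ((contDiffAt_norm ℝ hz).pow _) (pow_ne_zero _ (norm_ne_zero_iff.2 hz))
  fun_prop

noncomputable section

/-- A radial smooth cutoff, equal to `1` on the unit ball and supported in the ball of
radius `2`. -/
def cutoff (d : ℕ) : ContDiffBump (0 : EuclideanSpace ℝ (Fin d)) := ⟨1, 2, one_pos, one_lt_two⟩

/-- The part of the Riesz kernel near its singularity, supported in the ball of radius `2`. -/
def nearKernel {d : ℕ} (i : Fin d) (z : EuclideanSpace ℝ (Fin d)) : ℝ :=
  cutoff d z * rieszKernel i z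

/-- The part of the Riesz kernel away from its singularity: a smooth function, equal to the Riesz
kernel outside the ball of radius `2`. -/
def farKernel {d : ℕ} (i : Fin d) (z : EuclideanSpace ℝ (Fin d)) : ℝ :=
  (1 - cutoff d z) * rieszKernel i z

end

theorem nearKernel_add_farKernel {d : ℕ} (i : Fin d) (z : EuclideanSpace ℝ (Fin d)) :
    nearKernel i z + farKernel i z = rieszKernel i z := by
  simp only [nearKernel, farKernel]; ring

theorem farKernel_neg {d : ℕ} (i : Fin d) (z : EuclideanSpace ℝ (Fin d)) :
    farKernel i (-z) = -farKernel i z := by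
  simp [farKernel, rieszKernel_neg, (cutoff d).neg]

theorem cutoff_eq_zero {d : ℕ} {z : EuclideanSpace ℝ (Fin d)} (hz : 2 ≤ ‖z‖) : cutoff d z = 0 :=
  (cutoff d).zero_of_le_dist (by simpa [cutoff] using hz)

theorem farKernel_eq {d : ℕ} (i : Fin d) {z : EuclideanSpace ℝ (Fin d)} (hz : 2 ≤ ‖z‖) :
    farKernel i z = rieszKernel i z := by
  simp [farKernel, cutoff_eq_zero hz]

theorem nearKernel_eq_zero {d : ℕ} (i : Fin d) {z : EuclideanSpace ℝ (Fin d)} (hz : 2 ≤ ‖z‖) :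
    nearKernel i z = 0 := by
  simp [nearKernel, cutoff_eq_zero hz]

theorem measurable_nearKernel {d : ℕ} (i : Fin d) : Measurable (nearKernel i) :=
  (cutoff d).continuous.measurable.mul (measurable_rieszKernel i)

theorem abs_nearKernel_le {d : ℕ} (i : Fin d) (z : EuclideanSpace ℝ (Fin d)) :
    |nearKernel i z| ≤ (‖z‖ ^ d)⁻¹ := by
  rw [nearKernel, abs_mul, abs_of_nonneg (cutoff d).nonneg]
  exact (mul_le_of_le_one_left (abs_nonneg _) (cutoff d).le_one).trans (abs_rieszKernel_le i z)

theorem contDiff_farKernel {d : ℕ} (i : Fin d) (n : ℕ) : ContDiff ℝ n (farKernel i) := by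
  rw [contDiff_iff_contDiffAt]
  intro z
  rcases eq_or_ne z 0 with rfl | hz
  · have h : farKernel i =ᶠ[𝓝 0] fun _ => 0 := by
      filter_upwards [(cutoff d).eventuallyEq_one] with z hz
      simp [farKernel, hz]
    exact contDiffAt_const.congr_of_eventuallyEq h
  · exact (contDiffAt_const.sub (cutoff d).contDiffAt).mul (contDiffAt_rieszKernel i hz n)

/-- The derivatives of the smooth part of the Riesz kernel decay as the homogeneity of the Riesz
kernel predicts: a point of norm at least `3` is dilated back to the sphere of radius `3`, on which
the derivatives are bounded by compactness. -/
theorem exists_norm_iteratedFDeriv_farKernel_le {d : ℕ} (i : Fin d) (k : ℕ) :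
    ∃ C : ℝ, 0 ≤ C ∧ ∀ z, ‖iteratedFDeriv ℝ k (farKernel i) z‖ * (1 + ‖z‖) ^ (d + k) ≤ C := by
  have hcont : Continuous (iteratedFDeriv ℝ k (farKernel i)) :=
    (contDiff_farKernel i k).continuous_iteratedFDeriv le_rfl
  obtain ⟨M, hM⟩ := (isCompact_closedBall (0 : EuclideanSpace ℝ (Fin d))
    3).exists_bound_of_continuousOn hcont.continuousOn
  have hM0 : 0 ≤ M := (norm_nonneg _).trans (hM 0 (by simp))
  refine ⟨M * 4 ^ (d + k), by positivity, fun z => ?_⟩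
  rcases le_or_gt ‖z‖ 3 with hz | hz
  · gcongr
    · exact hM z (by simpa using hz)
    · linarith
  set a : ℝ := ‖z‖ / 3 with ha
  have ha1 : 1 < a := by rw [ha]; linarith
  have ha0 : 0 < a := by linarith
  set u : EuclideanSpace ℝ (Fin d) := a⁻¹ • z with hu
  have hzu : z = a • u := by rw [hu, smul_inv_smul₀ ha0.ne']
  have hnu : ‖u‖ = 3 := by
    rw [hu, norm_smul, norm_inv, Real.norm_eq_abs, abs_of_pos ha0, ha]
    field_simp
  have hloc : (fun w => farKernel i (a • w)) =ᶠ[𝓝 u] (a ^ d)⁻¹ • farKernel i := by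
    have : ∀ᶠ w : EuclideanSpace ℝ (Fin d) in 𝓝 u, 2 < ‖w‖ :=
      continuous_norm.continuousAt.eventually (lt_mem_nhds (by simp only [hnu]; norm_num))
    filter_upwards [this] with w hw
    have h2 : 2 ≤ ‖a • w‖ := by
      rw [norm_smul, Real.norm_eq_abs, abs_of_pos ha0]
      nlinarith
    rw [farKernel_eq i h2, Pi.smul_apply, farKernel_eq i hw.le, rieszKernel_smul i ha0, smul_eq_mul]
  have h1 := (hloc.iteratedFDeriv ℝ k).eq_of_nhds
  rw [iteratedFDeriv_comp_const_smul a (contDiff_farKernel i k),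
    iteratedFDeriv_const_smul_apply (contDiff_farKernel i k).contDiffAt] at h1
  have h2 := congrArg norm h1
  simp only [norm_smul, norm_pow, norm_inv, Real.norm_eq_abs, abs_of_pos ha0, ← hzu] at h2
  have h3 : ‖iteratedFDeriv ℝ k (farKernel i) z‖ * a ^ (d + k) ≤ M := by
    have : ‖iteratedFDeriv ℝ k (farKernel i) z‖ * a ^ (d + k) =
        ‖iteratedFDeriv ℝ k (farKernel i) u‖ := by
      rw [pow_add, mul_comm (a ^ d), ← mul_assoc, mul_comm _ (a ^ k), h2]
      field_simp
    rw [this]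
    exact hM u (by simp [hnu])
  calc ‖iteratedFDeriv ℝ k (farKernel i) z‖ * (1 + ‖z‖) ^ (d + k)
      ≤ ‖iteratedFDeriv ℝ k (farKernel i) z‖ * (4 * a) ^ (d + k) := by
        gcongr
        rw [ha]; linarith
    _ = (‖iteratedFDeriv ℝ k (farKernel i) z‖ * a ^ (d + k)) * 4 ^ (d + k) := by
        rw [mul_pow]; ring
    _ ≤ _ := by gcongr

/-- The Riesz kernel is locally integrable against functions that vanish to first order at the
origin. -/
theorem integrableOn_norm_mul_inv_pow {d : ℕ} (i : Fin d) (r : ℝ) :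
    IntegrableOn (fun z : EuclideanSpace ℝ (Fin d) => ‖z‖ * (‖z‖ ^ d)⁻¹) (Metric.ball 0 r) := by
  have : Nonempty (Fin d) := ⟨i⟩
  have hd : 0 < d := i.pos
  rw [integrableOn_fun_norm_addHaar volume (f := fun t => t * (t ^ d)⁻¹)]
  refine (integrableOn_const (C := (1 : ℝ)) (by simp)).congr_fun (fun t ht => ?_) measurableSet_Ioo
  have ht0 : 0 < t := ht.1
  obtain ⟨m, rfl⟩ : ∃ m, d = m + 1 := ⟨d - 1, by omega⟩
  simp only [finrank_euclideanSpace, Fintype.card_fin, Nat.add_sub_cancel, smul_eq_mul, pow_succ]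
  field_simp

theorem integrable_norm_mul_nearKernel {d : ℕ} (i : Fin d) :
    Integrable (fun z => ‖z‖ * |nearKernel i z|) := by
  have h := (integrableOn_norm_mul_inv_pow i 2).integrable_indicator Metric.isOpen_ball.measurableSet
  refine h.mono' (by have := measurable_nearKernel i; fun_prop) (Eventually.of_forall fun z => ?_)
  rw [Real.norm_eq_abs, abs_of_nonneg (by positivity)]
  by_cases hz : z ∈ Metric.ball (0 : EuclideanSpace ℝ (Fin d)) 2
  · rw [Set.indicator_of_mem hz]
    gcongr
    exact abs_nearKernel_le i z
  · rw [Set.indicator_of_notMem hz, nearKernel_eq_zero i (by simpa using hz)]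
    simp

/-! ### Taylor expansion of the smooth part of the kernel -/

/-- The Taylor polynomial of `y ↦ g (x - y)` at `0`, of degree less than `N`. -/
noncomputable def taylorSub {V : Type*} [NormedAddCommGroup V] [NormedSpace ℝ V] (N : ℕ)
    (g : V → ℝ) (x y : V) : ℝ :=
  ∑ k ∈ Finset.range N, (k.factorial : ℝ)⁻¹ * iteratedFDeriv ℝ k g x (fun _ => -y)

/-- The Taylor remainder is controlled by the last derivative on the segment from `x` to `x - y`. -/
theorem abs_sub_taylorSub_le {V : Type*} [NormedAddCommGroup V] [NormedSpace ℝ V] {n : ℕ}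
    {g : V → ℝ} (hg : ContDiff ℝ (n + 1 : ℕ) g) {x y : V} {C : ℝ}
    (hC : ∀ t ∈ Set.Icc (0 : ℝ) 1, ‖iteratedFDeriv ℝ (n + 1) g (x + t • -y)‖ ≤ C) :
    |g (x - y) - taylorSub (n + 1) g x y| ≤ C * ‖y‖ ^ (n + 1) := by
  have h := map_add_eq_sum_add_integral_iteratedFDeriv (f := g) (x := x) (y := -y) (n := n)
    (fun t _ => by exact_mod_cast hg.contDiffAt)
  have hC0 : 0 ≤ C := (norm_nonneg _).trans (hC 0 (by simp))
  rw [sub_eq_add_neg x y, h, taylorSub]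
  simp only [smul_eq_mul, add_sub_cancel_left]
  have hint : ‖∫ t in (0 : ℝ)..1, (1 - t) ^ n * iteratedFDeriv ℝ (n + 1) g (x + t • -y) (fun _ => -y)‖
      ≤ (C * ‖y‖ ^ (n + 1)) * |1 - 0| := by
    apply intervalIntegral.norm_integral_le_of_norm_le_const
    intro t ht
    rw [Set.uIoc_of_le zero_le_one] at ht
    rw [norm_mul, norm_pow, Real.norm_eq_abs, abs_of_nonneg (by linarith [ht.2])]
    have h1 : (1 - t) ^ n ≤ 1 := pow_le_one₀ (by linarith [ht.2]) (by linarith [ht.1])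
    have h2 : ‖iteratedFDeriv ℝ (n + 1) g (x + t • -y) (fun _ => -y)‖ ≤ C * ‖y‖ ^ (n + 1) := by
      refine (ContinuousMultilinearMap.le_opNorm _ _).trans ?_
      simp only [norm_neg, Finset.prod_const, Finset.card_univ, Fintype.card_fin]
      gcongr
      exact hC t ⟨ht.1.le, ht.2⟩
    calc _ ≤ 1 * (C * ‖y‖ ^ (n + 1)) := by gcongr
      _ = _ := one_mul _
  have hfac : ((n.factorial : ℝ))⁻¹ ≤ 1 := inv_le_one_of_one_le₀ (by exact_mod_cast n.factorial_pos)
  rw [abs_mul, abs_of_nonneg (by positivity : (0 : ℝ) ≤ (n.factorial : ℝ)⁻¹)]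
  rw [sub_zero, abs_one, mul_one, Real.norm_eq_abs] at hint
  calc _ ≤ 1 * (C * ‖y‖ ^ (n + 1)) := by gcongr
    _ = _ := one_mul _

theorem continuous_taylorSub {V : Type*} [NormedAddCommGroup V] [NormedSpace ℝ V] (N : ℕ)
    {g : V → ℝ} (hg : ∀ n : ℕ, ContDiff ℝ n g) :
    Continuous fun p : V × V => taylorSub N g p.1 p.2 := by
  unfold taylorSub
  refine continuous_finsetSum _ fun k _ => continuous_const.mul ?_
  have h1 : Continuous fun p : V × V => iteratedFDeriv ℝ k g p.1 :=
    ((hg k).continuous_iteratedFDeriv le_rfl).comp continuous_fst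
  have h2 : Continuous fun p : V × V => (fun _ : Fin k => -p.2) := by fun_prop
  exact h1.eval h2

/-- The error of the Taylor expansion of `farKernel i (x - y)` at `y = 0`. When
`2 * ‖y‖ ≤ 1 + ‖x‖` it is bounded by the last derivative on the segment from `x` to `x - y`;
otherwise all terms are bounded separately. The exponent `n + δ`, with `δ > 0`, absorbs a logarithm
that would appear with exponent `n` when the bound is integrated in `x`. -/
theorem exists_abs_farKernel_sub_taylorSub_le {d : ℕ} (i : Fin d) (n : ℕ) {δ : ℝ} (hδ : 0 < δ)
    (hδ1 : δ ≤ 1) :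
    ∃ C : ℝ, 0 ≤ C ∧ ∀ x y : EuclideanSpace ℝ (Fin d),
      (1 + ‖x‖) ^ n * |farKernel i (x - y) - taylorSub (n + 1) (farKernel i) x y| ≤
        C * ‖y‖ ^ (n + δ) * ((1 + ‖x‖) ^ (-(d + δ)) + (1 + ‖x - y‖) ^ (-(d + δ))) := by
  choose c hc0 hc using exists_norm_iteratedFDeriv_farKernel_le i
  have hder : ∀ k z, ‖iteratedFDeriv ℝ k (farKernel i) z‖ ≤ c k / (1 + ‖z‖) ^ (d + k) := by
    intro k z
    rw [le_div_iff₀ (by positivity)]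
    exact hc k z
  have hS : 0 ≤ ∑ k ∈ Finset.range (n + 1), c k * 2 ^ (n + 1) :=
    Finset.sum_nonneg fun k _ => mul_nonneg (hc0 k) (by positivity)
  have h0 := hc0 0
  have h1 := hc0 (n + 1)
  refine ⟨c (n + 1) * 2 ^ (d + (n + 1)) +
    (2 ^ n * c 0 * 3 + ∑ k ∈ Finset.range (n + 1), c k * 2 ^ (n + 1)),
    by positivity, fun x y => ?_⟩
  set w : ℝ := 1 + ‖x‖ with hw
  set u : ℝ := 1 + ‖x - y‖ with hu
  set t : ℝ := ‖y‖ with ht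
  have hw1 : 1 ≤ w := by rw [hw]; linarith [norm_nonneg x]
  have hu1 : 1 ≤ u := by rw [hu]; linarith [norm_nonneg (x - y)]
  have ht0 : 0 ≤ t := norm_nonneg y
  have hw0 : 0 < w := by linarith
  have hu0 : 0 < u := by linarith
  rcases le_or_gt (2 * t) w with hcase | hcase
  · -- the segment from `x` to `x - y` stays at norm comparable to that of `x`
    have hseg : ∀ s ∈ Set.Icc (0 : ℝ) 1, ‖iteratedFDeriv ℝ (n + 1) (farKernel i) (x + s • -y)‖ ≤
        c (n + 1) / (w / 2) ^ (d + (n + 1)) := by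
      intro s hs
      refine (hder _ _).trans ?_
      have h2 : w / 2 ≤ 1 + ‖x + s • -y‖ := by
        have h3 : ‖x‖ ≤ ‖x + s • -y‖ + ‖s • y‖ := by
          have := norm_sub_le (x + s • -y) (s • -y)
          simpa using this
        have h4 : ‖s • y‖ ≤ t := by
          rw [norm_smul, Real.norm_eq_abs, abs_of_nonneg hs.1]
          exact mul_le_of_le_one_left ht0 hs.2
        linarith
      gcongr
    have h2 := abs_sub_taylorSub_le (contDiff_farKernel i (n + 1)) hseg
    have h3 : t ^ (n + 1) ≤ t ^ (n + δ) * w ^ (1 - δ) := by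
      have h4 : t ^ (n + 1) = t ^ (n + δ) * t ^ (1 - δ) := by
        rw [← Real.rpow_add_of_nonneg ht0 (by positivity) (by linarith), ← Real.rpow_natCast]
        congr 1; push_cast; ring
      rw [h4]
      gcongr
      linarith
    have h5 : w ^ n * (w ^ (d + (n + 1)))⁻¹ * w ^ (1 - δ) = w ^ (-(d + δ)) := by
      rw [← Real.rpow_natCast, ← Real.rpow_natCast, ← Real.rpow_neg hw0.le,
        ← Real.rpow_add hw0, ← Real.rpow_add hw0]
      congr 1; push_cast; ring
    calc w ^ n * |farKernel i (x - y) - taylorSub (n + 1) (farKernel i) x y|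
        ≤ w ^ n * (c (n + 1) / (w / 2) ^ (d + (n + 1)) * t ^ (n + 1)) := by gcongr
      _ ≤ w ^ n * (c (n + 1) / (w / 2) ^ (d + (n + 1)) * (t ^ (n + δ) * w ^ (1 - δ))) := by gcongr
      _ = c (n + 1) * 2 ^ (d + (n + 1)) * t ^ (n + δ) *
          (w ^ n * (w ^ (d + (n + 1)))⁻¹ * w ^ (1 - δ)) := by
        rw [div_pow]; field_simp
      _ = c (n + 1) * 2 ^ (d + (n + 1)) * t ^ (n + δ) * w ^ (-(d + δ)) := by rw [h5]
      _ ≤ _ := by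
        gcongr
        · exact le_add_of_nonneg_right (by positivity)
        · exact le_add_of_nonneg_right (by positivity)
  · -- here `1 + ‖x‖` and `1 + ‖x - y‖` are at most `3 * ‖y‖`, so spare powers of them go into `‖y‖`
    have htpos : 0 < t := by linarith
    have hK : w ^ n * |farKernel i (x - y)| ≤ 2 ^ n * c 0 * 3 * t ^ (n + δ) * u ^ (-(d + δ)) := by
      have h2 : |farKernel i (x - y)| ≤ c 0 * (u ^ (-(d + δ)) * u ^ δ) := by
        have h3 := hder 0 (x - y)
        rw [norm_iteratedFDeriv_zero, Real.norm_eq_abs, add_zero, div_eq_mul_inv,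
          ← Real.rpow_natCast, ← Real.rpow_neg (by positivity)] at h3
        rw [← Real.rpow_add hu0]
        convert h3 using 3
        ring
      have h3 : u ≤ 3 * t := by
        have := norm_sub_le x y
        linarith
      have h4 : u ^ δ ≤ 3 * t ^ δ := by
        calc u ^ δ ≤ (3 * t) ^ δ := by gcongr
          _ = 3 ^ δ * t ^ δ := Real.mul_rpow (by norm_num) ht0
          _ ≤ 3 ^ (1 : ℝ) * t ^ δ := by gcongr; norm_num
          _ = _ := by rw [Real.rpow_one]
      calc w ^ n * |farKernel i (x - y)| ≤ (2 * t) ^ n * (c 0 * (u ^ (-(d + δ)) * (3 * t ^ δ))) := by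
            gcongr
            exact h2.trans (by gcongr)
        _ = 2 ^ n * c 0 * 3 * (t ^ n * t ^ δ) * u ^ (-(d + δ)) := by rw [mul_pow]; ring
        _ = _ := by rw [Real.rpow_add htpos, Real.rpow_natCast]
    have hT : w ^ n * |taylorSub (n + 1) (farKernel i) x y| ≤
        (∑ k ∈ Finset.range (n + 1), c k * 2 ^ (n + 1)) * t ^ (n + δ) * w ^ (-(d + δ)) := by
      rw [taylorSub]
      refine (mul_le_mul_of_nonneg_left (Finset.abs_sum_le_sum_abs _ _) (by positivity)).trans ?_
      rw [Finset.mul_sum, Finset.sum_mul, Finset.sum_mul]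
      refine Finset.sum_le_sum fun k hk => ?_
      have hkn : k ≤ n := by simpa [Nat.lt_succ_iff] using hk
      have hkn' : (k : ℝ) ≤ n := by exact_mod_cast hkn
      have hck := hc0 k
      have hfac : ((k.factorial : ℝ))⁻¹ ≤ 1 :=
        inv_le_one_of_one_le₀ (by exact_mod_cast k.factorial_pos)
      have h2 : |iteratedFDeriv ℝ k (farKernel i) x (fun _ => -y)| ≤ c k / w ^ (d + k) * t ^ k := by
        rw [← Real.norm_eq_abs]
        refine (ContinuousMultilinearMap.le_opNorm _ _).trans ?_
        simp only [norm_neg, Finset.prod_const, Finset.card_univ, Fintype.card_fin]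
        gcongr
        exact hder k x
      have h3 : w ^ n * (w ^ (d + k))⁻¹ = w ^ (n - k + δ) * w ^ (-(d + δ)) := by
        rw [← Real.rpow_natCast, ← Real.rpow_natCast, ← Real.rpow_neg hw0.le,
          ← Real.rpow_add hw0, ← Real.rpow_add hw0]
        congr 1; push_cast; ring
      have h4 : w ^ (n - k + δ) ≤ 2 ^ (n + 1) * t ^ (n - k + δ) := by
        calc w ^ (n - k + δ) ≤ (2 * t) ^ (n - k + δ) := by
              gcongr
          _ = 2 ^ (n - k + δ) * t ^ (n - k + δ) := Real.mul_rpow (by norm_num) ht0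
          _ ≤ 2 ^ ((n + 1 : ℕ) : ℝ) * t ^ (n - k + δ) := by
              gcongr
              · norm_num
              · push_cast
                linarith [(Nat.cast_nonneg k : (0 : ℝ) ≤ k)]
          _ = _ := by rw [Real.rpow_natCast]
      have h5 : t ^ (n - k + δ) * t ^ k = t ^ (n + δ) := by
        rw [← Real.rpow_natCast, ← Real.rpow_add htpos]
        congr 1; ring
      rw [abs_mul, abs_of_nonneg (by positivity : (0 : ℝ) ≤ (k.factorial : ℝ)⁻¹)]
      calc w ^ n * ((k.factorial : ℝ)⁻¹ * |iteratedFDeriv ℝ k (farKernel i) x (fun _ => -y)|)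
          ≤ w ^ n * (1 * (c k / w ^ (d + k) * t ^ k)) := by gcongr
        _ = c k * t ^ k * (w ^ n * (w ^ (d + k))⁻¹) := by field_simp
        _ = c k * t ^ k * (w ^ (n - k + δ) * w ^ (-(d + δ))) := by rw [h3]
        _ ≤ c k * t ^ k * ((2 ^ (n + 1) * t ^ (n - k + δ)) * w ^ (-(d + δ))) := by gcongr
        _ = c k * 2 ^ (n + 1) * (t ^ (n - k + δ) * t ^ k) * w ^ (-(d + δ)) := by ring
        _ = _ := by rw [h5]
    set S := ∑ k ∈ Finset.range (n + 1), c k * 2 ^ (n + 1)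
    set A := c (n + 1) * 2 ^ (d + (n + 1)) with hA
    have hA0 : 0 ≤ A := by positivity
    set B := 2 ^ n * c 0 * 3 with hB
    have hB0 : 0 ≤ B := by positivity
    set p := w ^ (-(d + δ))
    set q := u ^ (-(d + δ))
    have hp : 0 ≤ p := by positivity
    have hq : 0 ≤ q := by positivity
    set T := t ^ (n + δ)
    have hT0 : 0 ≤ T := by positivity
    calc w ^ n * |farKernel i (x - y) - taylorSub (n + 1) (farKernel i) x y|
        ≤ w ^ n * (|farKernel i (x - y)| + |taylorSub (n + 1) (farKernel i) x y|) := by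
          gcongr; exact abs_sub _ _
      _ ≤ B * T * q + S * T * p := by rw [mul_add]; exact add_le_add hK hT
      _ ≤ B * T * q + S * T * p + (A * T * (p + q) + B * T * p + S * T * q) :=
          le_add_of_nonneg_right (by positivity)
      _ = _ := by ring

/-! ### Polynomial moments of functions of the class `L_N` -/

theorem abs_monomialFn_le {d : ℕ} {β : Fin d → ℕ} {m : ℕ} (hβ : ∑ k, β k ≤ m)
    (x : EuclideanSpace ℝ (Fin d)) : |monomialFn β x| ≤ (1 + ‖x‖) ^ m := by
  rw [monomialFn, Finset.abs_prod]
  calc ∏ k, |x k ^ β k| ≤ ∏ k, (1 + ‖x‖) ^ β k := by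
        refine Finset.prod_le_prod (fun _ _ => abs_nonneg _) fun k _ => ?_
        rw [abs_pow]
        gcongr
        have := PiLp.norm_apply_le x k
        rw [Real.norm_eq_abs] at this
        linarith
    _ = (1 + ‖x‖) ^ ∑ k, β k := Finset.prod_pow_eq_pow_sum _ _ _
    _ ≤ _ := pow_le_pow_right₀ (by linarith [norm_nonneg x]) hβ

theorem continuous_monomialFn {d : ℕ} (β : Fin d → ℕ) : Continuous (monomialFn β) := by
  unfold monomialFn
  fun_prop

theorem monomialFn_smul {d : ℕ} (β : Fin d → ℕ) (a : ℝ) (x : EuclideanSpace ℝ (Fin d)) :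
    monomialFn β (a • x) = a ^ (∑ k, β k) * monomialFn β x := by
  simp only [monomialFn, PiLp.smul_apply, smul_eq_mul, mul_pow, Finset.prod_mul_distrib,
    Finset.prod_pow_eq_pow_sum]

theorem opNorm_le_of_abs_apply_single_le {d : ℕ} (L : EuclideanSpace ℝ (Fin d) →L[ℝ] ℝ) {B : ℝ} (hB : 0 ≤ B)
    (h : ∀ k, |L (EuclideanSpace.single k 1)| ≤ B) : ‖L‖ ≤ d * B := by
  refine ContinuousLinearMap.opNorm_le_bound _ (by positivity) fun x => ?_
  have hx : x = ∑ k, x k • EuclideanSpace.single k (1 : ℝ) := by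
    ext j
    simp [Pi.single_apply]
  calc ‖L x‖ = |∑ k, x k * L (EuclideanSpace.single k 1)| := by
        conv_lhs => rw [hx]
        simp
    _ ≤ ∑ k, |x k * L (EuclideanSpace.single k 1)| := Finset.abs_sum_le_sum_abs _ _
    _ ≤ ∑ _k : Fin d, ‖x‖ * B := by
        refine Finset.sum_le_sum fun k _ => ?_
        rw [abs_mul]
        gcongr
        · exact PiLp.norm_apply_le x k
        · exact h k
    _ = d * B * ‖x‖ := by simp; ring

namespace MemL

variable {d N : ℕ} {f : EuclideanSpace ℝ (Fin d) → ℝ}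

/-- Growth exponents slightly above `N - 1` are still integrable against `f`. -/
theorem exists_integrable_rpow (hf : MemL N f) : ∃ δ : ℝ, 0 < δ ∧ δ ≤ 1 ∧
    Integrable fun x => (1 + ‖x‖) ^ ((N : ℝ) - 1 + δ) * |f x| := by
  obtain ⟨C, ε, hC, hε, hε1, hdec, -⟩ := hf.decay
  -- with this `δ`, the weighted function decays with exponent `d + (1 - ε) / 2 > d`
  refine ⟨(1 - ε) / 2, by linarith, by linarith, ?_⟩
  have hint := (integrable_one_add_norm (E := EuclideanSpace ℝ (Fin d)) (μ := volume)
    (r := d + (1 - ε) / 2) (by simp; linarith)).const_mul C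
  refine hint.mono' ?_ (Eventually.of_forall fun x => ?_)
  · have := hf.differentiable.continuous
    have h : Continuous fun x : EuclideanSpace ℝ (Fin d) => (1 + ‖x‖) ^ ((N : ℝ) - 1 + (1 - ε) / 2) :=
      (by fun_prop : Continuous fun x : EuclideanSpace ℝ (Fin d) => 1 + ‖x‖).rpow_const
        fun x => Or.inl (by positivity)
    exact (h.mul this.abs).aestronglyMeasurable
  · rw [Real.norm_eq_abs, abs_of_nonneg (by positivity)]
    calc (1 + ‖x‖) ^ ((N : ℝ) - 1 + (1 - ε) / 2) * |f x|
        ≤ (1 + ‖x‖) ^ ((N : ℝ) - 1 + (1 - ε) / 2) * (C * (1 + ‖x‖) ^ (-(d : ℝ) - N + ε)) := by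
          gcongr; exact hdec x
      _ = C * (1 + ‖x‖) ^ (-(d + (1 - ε) / 2)) := by
          rw [mul_left_comm, ← Real.rpow_add (by positivity)]
          congr 2; ring

theorem integrable_pow_mul (hf : MemL N f) {m : ℕ} (hm : m < N) :
    Integrable fun x => (1 + ‖x‖) ^ m * |f x| := by
  obtain ⟨δ, hδ, -, h⟩ := hf.exists_integrable_rpow
  have := hf.differentiable.continuous
  refine h.mono' (by fun_prop) (Eventually.of_forall fun x => ?_)
  rw [Real.norm_eq_abs, abs_of_nonneg (by positivity), ← Real.rpow_natCast]
  have : (m : ℝ) + 1 ≤ N := by exact_mod_cast hm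
  gcongr
  · linarith [norm_nonneg x]
  · linarith

theorem integrable (hf : MemL N f) (hN : 1 ≤ N) : Integrable f := by
  have h := hf.integrable_pow_mul (m := 0) hN
  simp only [pow_zero, one_mul] at h
  exact (integrable_norm_iff hf.differentiable.continuous.aestronglyMeasurable).1 h

theorem integrable_monomialFn_mul (hf : MemL N f) {β : Fin d → ℕ} (hβ : ∑ k, β k < N) :
    Integrable fun x => monomialFn β x * f x := by
  have h1 := hf.differentiable.continuous
  have h2 := continuous_monomialFn β
  refine (hf.integrable_pow_mul hβ).mono' (by fun_prop) (Eventually.of_forall fun x => ?_)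
  rw [norm_mul, Real.norm_eq_abs, Real.norm_eq_abs]
  gcongr
  exact abs_monomialFn_le le_rfl x

/-- A function of the class `L_N` is orthogonal to all polynomials of degree less than `N`. -/
theorem integral_eval_mul (hf : MemL N f) {P : MvPolynomial (Fin d) ℝ} (hP : P.totalDegree < N) :
    Integrable (fun x : EuclideanSpace ℝ (Fin d) => MvPolynomial.eval x P * f x) ∧
      ∫ x : EuclideanSpace ℝ (Fin d), MvPolynomial.eval x P * f x = 0 := by
  have hdeg : ∀ s ∈ P.support, ∑ k, s k < N := fun s hs =>
    lt_of_le_of_lt (by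
      have := MvPolynomial.le_totalDegree hs
      rwa [Finsupp.sum_fintype _ _ (fun _ => rfl)] at this) hP
  have heq : (fun x : EuclideanSpace ℝ (Fin d) => MvPolynomial.eval x P * f x) =
      fun x => ∑ s ∈ P.support, P.coeff s * (monomialFn (fun k => s k) x * f x) := by
    funext x
    rw [MvPolynomial.eval_eq', Finset.sum_mul]
    simp only [monomialFn, mul_assoc]
  have hint : ∀ s ∈ P.support,
      Integrable fun x => P.coeff s * (monomialFn (fun k => s k) x * f x) :=
    fun s hs => (hf.integrable_monomialFn_mul (hdeg s hs)).const_mul _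
  rw [heq]
  refine ⟨integrable_finsetSum _ hint, ?_⟩
  rw [integral_finsetSum _ hint]
  refine Finset.sum_eq_zero fun s hs => ?_
  rw [integral_const_mul, hf.moments _ (hdeg s hs), mul_zero]

/-- Vanishing moments are invariant under translation. -/
theorem integral_monomialFn_mul_sub (hf : MemL N f) {β : Fin d → ℕ} (hβ : ∑ k, β k < N)
    (z : EuclideanSpace ℝ (Fin d)) :
    Integrable (fun x => monomialFn β x * f (x - z)) ∧ ∫ x, monomialFn β x * f (x - z) = 0 := by
  -- `P` is the monomial `β` recentred so that `P (x - z) = x ^ β`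
  set P : MvPolynomial (Fin d) ℝ := ∏ k, (MvPolynomial.X k + MvPolynomial.C (z k)) ^ β k with hPdef
  have hP : P.totalDegree < N := by
    refine lt_of_le_of_lt ?_ hβ
    refine (MvPolynomial.totalDegree_finsetProd _ _).trans (Finset.sum_le_sum fun k _ => ?_)
    refine (MvPolynomial.totalDegree_pow _ _).trans ?_
    have : (MvPolynomial.X k + MvPolynomial.C (z k) : MvPolynomial (Fin d) ℝ).totalDegree ≤ 1 :=
      (MvPolynomial.totalDegree_add _ _).trans (by simp)
    nlinarith
  have heval : ∀ x : EuclideanSpace ℝ (Fin d), MvPolynomial.eval (x - z) P = monomialFn β x := by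
    intro x
    simp [hPdef, monomialFn]
  obtain ⟨h1, h2⟩ := hf.integral_eval_mul hP
  have h3 := h1.comp_sub_right z
  have h4 := integral_sub_right_eq_self
    (fun x : EuclideanSpace ℝ (Fin d) => MvPolynomial.eval x P * f x) z (μ := volume)
  simp only [heval] at h3 h4
  exact ⟨h3, h4.trans h2⟩

/-- The Taylor polynomials of degree less than `N` are annihilated by `f`. -/
theorem integral_taylorSub_mul (hf : MemL N f) (g : EuclideanSpace ℝ (Fin d) → ℝ)
    (x : EuclideanSpace ℝ (Fin d)) :
    Integrable (fun y => taylorSub N g x y * f y) ∧ ∫ y, taylorSub N g x y * f y = 0 := by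
  have hk : ∀ k ∈ Finset.range N,
      Integrable (fun y => (k.factorial : ℝ)⁻¹ * iteratedFDeriv ℝ k g x (fun _ => -y) * f y) ∧
      ∫ y, (k.factorial : ℝ)⁻¹ * iteratedFDeriv ℝ k g x (fun _ => -y) * f y = 0 := by
    intro k hk
    set b : Fin d → EuclideanSpace ℝ (Fin d) := fun j => EuclideanSpace.single j 1
    -- expand the derivative, a multilinear form, in the standard basis
    set P : MvPolynomial (Fin d) ℝ := ∑ r : Fin k → Fin d,
      MvPolynomial.C ((k.factorial : ℝ)⁻¹ * iteratedFDeriv ℝ k g x (fun l => b (r l))) *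
        ∏ l, -MvPolynomial.X (r l) with hPdef
    have hP : P.totalDegree < N := by
      refine lt_of_le_of_lt ?_ (Finset.mem_range.1 hk)
      refine (MvPolynomial.totalDegree_finsetSum _ _).trans (Finset.sup_le fun r _ => ?_)
      refine (MvPolynomial.totalDegree_mul _ _).trans ?_
      rw [MvPolynomial.totalDegree_C, zero_add]
      refine (MvPolynomial.totalDegree_finsetProd _ _).trans ?_
      simp
    have heval : ∀ y : EuclideanSpace ℝ (Fin d), MvPolynomial.eval y P =
        (k.factorial : ℝ)⁻¹ * iteratedFDeriv ℝ k g x (fun _ => -y) := by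
      intro y
      have hy : -y = ∑ j, (-y j) • b j := by
        ext j
        simp [b, Pi.single_apply]
      conv_rhs => rw [hy]
      rw [ContinuousMultilinearMap.map_sum, Finset.mul_sum, hPdef, map_sum]
      refine Finset.sum_congr rfl fun r _ => ?_
      rw [ContinuousMultilinearMap.map_smul_univ]
      simp only [map_mul, map_prod, map_neg, MvPolynomial.eval_C, MvPolynomial.eval_X, smul_eq_mul]
      ring
    simpa only [heval] using hf.integral_eval_mul hP
  simp only [taylorSub, Finset.sum_mul]
  refine ⟨integrable_finsetSum _ fun k h => (hk k h).1, ?_⟩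
  rw [integral_finsetSum _ fun k h => (hk k h).1]
  exact Finset.sum_eq_zero fun k h => (hk k h).2

/-- A pointwise bound on symmetric differences, which inherit the decay of the gradient. -/
theorem exists_abs_sub_le (hf : MemL N f) : ∃ C ε : ℝ, 0 ≤ C ∧ ε < 1 ∧
    ∀ x z : EuclideanSpace ℝ (Fin d), ‖z‖ ≤ 2 →
      |f (x - z) - f (x + z)| ≤ C * ‖z‖ * (1 + ‖x‖) ^ (-(d : ℝ) - N - 1 + ε) := by
  obtain ⟨C, ε, hC, hε, hε1, -, hdec⟩ := hf.decay
  set r : ℝ := -(d : ℝ) - N - 1 + ε with hr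
  have hr0 : r ≤ 0 := by
    have h1 : (0 : ℝ) ≤ d := Nat.cast_nonneg d
    have h2 : (0 : ℝ) ≤ N := Nat.cast_nonneg N
    linarith
  refine ⟨d * (C * (1 / 3) ^ r) * 2, ε, by positivity, hε1, fun x z hz => ?_⟩
  have hbound : ∀ v ∈ Metric.closedBall x ‖z‖,
      ‖fderiv ℝ f v‖ ≤ d * (C * ((1 / 3) ^ r * (1 + ‖x‖) ^ r)) := by
    intro v hv
    refine opNorm_le_of_abs_apply_single_le _ (by positivity) fun k => (hdec k v).trans ?_
    -- as `‖v - x‖ ≤ ‖z‖ ≤ 2`, the weights at `v` and at `x` are comparable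
    have h1 : 1 / 3 * (1 + ‖x‖) ≤ 1 + ‖v‖ := by
      have h2 : ‖x‖ - ‖v‖ ≤ ‖v - x‖ := by
        rw [norm_sub_rev]; exact norm_sub_norm_le x v
      have h3 : ‖v - x‖ ≤ ‖z‖ := by simpa [dist_eq_norm] using hv
      linarith [norm_nonneg v]
    rw [← Real.mul_rpow (by norm_num) (by positivity)]
    exact mul_le_mul_of_nonneg_left (Real.rpow_le_rpow_of_nonpos (by positivity) h1 hr0) hC.le
  have h := (convex_closedBall x ‖z‖).norm_image_sub_le_of_norm_fderiv_le (𝕜 := ℝ) (f := f)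
    (fun v _ => hf.differentiable v) hbound (x := x + z) (y := x - z) (by simp) (by simp)
  rw [Real.norm_eq_abs] at h
  refine h.trans ?_
  have h2 : ‖x - z - (x + z)‖ = 2 * ‖z‖ := by
    have : x - z - (x + z) = (-2 : ℝ) • z := by module
    rw [this, norm_smul]; norm_num
  rw [h2]
  exact le_of_eq (by ring)

/-- The class `L_N` is invariant under dilations. -/
theorem comp_smul (hf : MemL N f) (hN1 : 1 ≤ N) {R : ℝ} (hR : 1 ≤ R) : MemL N fun x => f (R • x) := by
  have hR0 : 0 < R := by linarith
  refine ⟨fun x => (hf.differentiable _).comp x (by fun_prop), ?_, fun β hβ => ?_⟩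
  · obtain ⟨C, ε, hC, hε, hε1, hdec, hdec'⟩ := hf.decay
    have hd : (0 : ℝ) ≤ d := Nat.cast_nonneg d
    have hN : (0 : ℝ) ≤ N := Nat.cast_nonneg N
    have hle : ∀ {r : ℝ}, r ≤ 0 → ∀ x : EuclideanSpace ℝ (Fin d),
        (1 + ‖R • x‖) ^ r ≤ (1 + ‖x‖) ^ r := by
      intro r hr x
      refine Real.rpow_le_rpow_of_nonpos (by positivity) ?_ hr
      rw [norm_smul, Real.norm_eq_abs, abs_of_pos hR0]
      nlinarith [norm_nonneg x]
    refine ⟨C * R, ε, by positivity, hε, hε1, fun x => ?_, fun k x => ?_⟩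
    · calc |f (R • x)| ≤ C * (1 + ‖R • x‖) ^ (-(d : ℝ) - N + ε) := hdec _
        _ ≤ C * (1 + ‖x‖) ^ (-(d : ℝ) - N + ε) := by
            refine mul_le_mul_of_nonneg_left (hle ?_ x) hC.le
            have : (1 : ℝ) ≤ N := by exact_mod_cast hN1
            linarith
        _ ≤ _ := by
            gcongr
            nlinarith
    · rw [fderiv_comp_smul, smul_apply, smul_eq_mul, abs_mul, abs_of_pos hR0]
      calc R * |fderiv ℝ f (R • x) (EuclideanSpace.single k 1)|
          ≤ R * (C * (1 + ‖R • x‖) ^ (-(d : ℝ) - N - 1 + ε)) := by gcongr; exact hdec' k _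
        _ ≤ R * (C * (1 + ‖x‖) ^ (-(d : ℝ) - N - 1 + ε)) := by
            refine mul_le_mul_of_nonneg_left ?_ hR0.le
            exact mul_le_mul_of_nonneg_left (hle (by linarith) x) hC.le
        _ = _ := by ring
  · have h1 : ∀ x, monomialFn β x * f (R • x) =
        (R ^ (∑ k, β k))⁻¹ * (monomialFn β (R • x) * f (R • x)) := by
      intro x
      rw [monomialFn_smul]
      field_simp
    simp_rw [h1]
    rw [integral_const_mul, Measure.integral_comp_smul volume (fun x => monomialFn β x * f x),
      hf.moments β hβ]
    simp

end MemL

/-! ### The principal value as an absolutely convergent integral -/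

namespace MemL

variable {d N : ℕ} {f : EuclideanSpace ℝ (Fin d) → ℝ}

theorem integrable_nearKernel_mul (hf : MemL N f) (i : Fin d) (x : EuclideanSpace ℝ (Fin d)) :
    Integrable fun z => nearKernel i z * (f (x - z) - f (x + z)) := by
  obtain ⟨C, ε, hC, -, hb⟩ := hf.exists_abs_sub_le
  have hcont := hf.differentiable.continuous
  have hmeas := measurable_nearKernel i
  refine ((integrable_norm_mul_nearKernel i).mul_const
    (C * (1 + ‖x‖) ^ (-(d : ℝ) - N - 1 + ε))).mono' ?_ (Eventually.of_forall fun z => ?_)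
  · exact hmeas.aestronglyMeasurable.mul
      (by fun_prop : Continuous fun z => f (x - z) - f (x + z)).aestronglyMeasurable
  · rw [norm_mul, Real.norm_eq_abs, Real.norm_eq_abs]
    rcases le_or_gt 2 ‖z‖ with hz | hz
    · simp [nearKernel_eq_zero i hz]
    · calc _ ≤ |nearKernel i z| * (C * ‖z‖ * (1 + ‖x‖) ^ (-(d : ℝ) - N - 1 + ε)) := by
            gcongr; exact hb x z hz.le
        _ = _ := by ring

theorem integrable_farKernel_mul (hf : MemL N f) (hN : 1 ≤ N) (i : Fin d)
    (x : EuclideanSpace ℝ (Fin d)) : Integrable fun z => farKernel i z * f (x - z) := by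
  obtain ⟨C, hC, hb⟩ := exists_norm_iteratedFDeriv_farKernel_le i 0
  refine ((hf.integrable hN).comp_sub_left x).bdd_mul (c := C)
    (contDiff_farKernel i 0).continuous.aestronglyMeasurable (Eventually.of_forall fun z => ?_)
  refine le_trans ?_ (hb z)
  rw [norm_iteratedFDeriv_zero]
  exact le_mul_of_one_le_right (norm_nonneg _) (one_le_pow₀ (by linarith [norm_nonneg z]))

theorem integrable_farKernel_mul_add (hf : MemL N f) (hN : 1 ≤ N) (i : Fin d)
    (x : EuclideanSpace ℝ (Fin d)) : Integrable fun z => farKernel i z * f (x + z) := by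
  simpa [farKernel_neg] using (hf.integrable_farKernel_mul hN i x).comp_neg.neg

theorem integral_farKernel_mul_add (f : EuclideanSpace ℝ (Fin d) → ℝ) (i : Fin d)
    (x : EuclideanSpace ℝ (Fin d)) :
    ∫ z, farKernel i z * f (x + z) = -∫ z, farKernel i z * f (x - z) := by
  rw [← integral_neg_eq_self, ← integral_neg]
  simp [farKernel_neg, sub_eq_add_neg]

theorem integrable_rieszKernel_mul (hf : MemL N f) (hN : 1 ≤ N) (i : Fin d)
    (x : EuclideanSpace ℝ (Fin d)) :
    Integrable fun z => rieszKernel i z * (f (x - z) - f (x + z)) := by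
  refine ((hf.integrable_nearKernel_mul i x).add ((hf.integrable_farKernel_mul hN i x).sub
    (hf.integrable_farKernel_mul_add hN i x))).congr (Eventually.of_forall fun z => ?_)
  simp only [Pi.add_apply, Pi.sub_apply]
  rw [← nearKernel_add_farKernel]
  ring

theorem integrable_indicator_rieszKernel_mul (hf : MemL N f) (hN : 1 ≤ N) (i : Fin d)
    (x : EuclideanSpace ℝ (Fin d)) {η : ℝ} (hη : 0 < η) :
    Integrable fun z => {z | η < ‖z‖}.indicator (rieszKernel i) z * f (x - z) := by
  refine ((hf.integrable hN).comp_sub_left x).bdd_mul (c := (η ^ d)⁻¹)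
    ((measurable_rieszKernel i).indicator
      (measurableSet_lt measurable_const measurable_norm)).aestronglyMeasurable
    (Eventually.of_forall fun z => ?_)
  by_cases hz : η < ‖z‖
  · rw [Set.indicator_of_mem (by exact hz), Real.norm_eq_abs]
    refine (abs_rieszKernel_le i z).trans ?_
    gcongr
  · rw [Set.indicator_of_notMem (by exact hz), norm_zero]
    positivity

theorem indicator_mul_rieszKernel (f : EuclideanSpace ℝ (Fin d) → ℝ) (i : Fin d)
    (x : EuclideanSpace ℝ (Fin d)) (η : ℝ) :
    {y | η < ‖x - y‖}.indicator (fun y => f y * rieszKernel i (x - y)) =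
      fun y => {z | η < ‖z‖}.indicator (rieszKernel i) (x - y) * f (x - (x - y)) := by
  funext y
  by_cases hy : η < ‖x - y‖
  · rw [Set.indicator_of_mem (by exact hy), Set.indicator_of_mem (by exact hy), sub_sub_cancel,
      mul_comm]
  · rw [Set.indicator_of_notMem (by exact hy), Set.indicator_of_notMem (by exact hy), zero_mul]

theorem measurableSet_lt_norm_sub (x : EuclideanSpace ℝ (Fin d)) (η : ℝ) :
    MeasurableSet {y | η < ‖x - y‖} :=
  measurableSet_lt measurable_const (by fun_prop)

theorem integrableOn_mul_rieszKernel (hf : MemL N f) (hN : 1 ≤ N) (i : Fin d)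
    (x : EuclideanSpace ℝ (Fin d)) {η : ℝ} (hη : 0 < η) :
    IntegrableOn (fun y => f y * rieszKernel i (x - y)) {y | η < ‖x - y‖} := by
  rw [← integrable_indicator_iff (measurableSet_lt_norm_sub x η), indicator_mul_rieszKernel]
  exact (hf.integrable_indicator_rieszKernel_mul hN i x hη).comp_sub_left x

/-- The truncated integral is symmetrized by the oddness of the kernel. -/
theorem truncatedRiesz_eq (hf : MemL N f) (hN : 1 ≤ N) (i : Fin d)
    (x : EuclideanSpace ℝ (Fin d)) {η : ℝ} (hη : 0 < η) :
    truncatedRiesz i f η x = rieszConst d * (2⁻¹ * ∫ z,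
      {z | η < ‖z‖}.indicator (fun z => rieszKernel i z * (f (x - z) - f (x + z))) z) := by
  set g : EuclideanSpace ℝ (Fin d) → ℝ :=
    fun z => {z | η < ‖z‖}.indicator (rieszKernel i) z * f (x - z) with hg
  have hgi : Integrable g := hf.integrable_indicator_rieszKernel_mul hN i x hη
  have h1 : ∫ y in {y | η < ‖x - y‖}, f y * rieszKernel i (x - y) = ∫ z, g z := by
    rw [← integral_indicator (measurableSet_lt_norm_sub x η), indicator_mul_rieszKernel]
    exact integral_sub_left_eq_self g volume x
  have h2 : ∫ z, (g z + g (-z)) = 2 * ∫ z, g z := by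
    rw [integral_add hgi hgi.comp_neg, integral_neg_eq_self g volume]
    ring
  have h3 : ∀ z, {z | η < ‖z‖}.indicator (fun z => rieszKernel i z * (f (x - z) - f (x + z))) z =
      g z + g (-z) := by
    intro z
    by_cases hz : η < ‖z‖
    · have hz' : η < ‖-z‖ := by rwa [norm_neg]
      simp only [hg]
      rw [Set.indicator_of_mem (by exact hz), Set.indicator_of_mem (by exact hz),
        Set.indicator_of_mem (by exact hz'), rieszKernel_neg, sub_neg_eq_add]
      ring
    · have hz' : ¬ η < ‖-z‖ := by rwa [norm_neg]
      simp only [hg]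
      rw [Set.indicator_of_notMem (by exact hz), Set.indicator_of_notMem (by exact hz),
        Set.indicator_of_notMem (by exact hz')]
      ring
  simp_rw [h3]
  rw [truncatedRiesz, h1, h2]
  ring

theorem tendsto_truncatedRiesz (hf : MemL N f) (hN : 1 ≤ N) (i : Fin d)
    (x : EuclideanSpace ℝ (Fin d)) :
    Tendsto (fun η => truncatedRiesz i f η x) (𝓝[>] (0 : ℝ))
      (𝓝 (rieszConst d * (2⁻¹ * ∫ z, rieszKernel i z * (f (x - z) - f (x + z))))) := by
  have hG := hf.integrable_rieszKernel_mul hN i x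
  have hlim : Tendsto (fun η : ℝ => ∫ z,
      {z | η < ‖z‖}.indicator (fun z => rieszKernel i z * (f (x - z) - f (x + z))) z)
      (𝓝[>] (0 : ℝ)) (𝓝 (∫ z, rieszKernel i z * (f (x - z) - f (x + z)))) := by
    refine tendsto_integral_filter_of_dominated_convergence _
      (Eventually.of_forall fun η => hG.aestronglyMeasurable.indicator
        (measurableSet_lt measurable_const measurable_norm))
      (Eventually.of_forall fun η => Eventually.of_forall fun z => norm_indicator_le_norm_self _ _)
      hG.norm (Eventually.of_forall fun z => tendsto_nhds_of_eventually_eq ?_)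
    -- at `z = 0` the difference of values of `f` vanishes
    rcases eq_or_ne z 0 with rfl | hz
    · simp
    · have : ∀ᶠ η : ℝ in 𝓝[>] 0, η < ‖z‖ :=
        mem_nhdsWithin_of_mem_nhds (gt_mem_nhds (norm_pos_iff.2 hz))
      filter_upwards [this] with η hη
      exact Set.indicator_of_mem (by exact hη) _
  refine ((hlim.const_mul 2⁻¹).const_mul (rieszConst d)).congr' ?_
  filter_upwards [self_mem_nhdsWithin] with η hη
  exact (hf.truncatedRiesz_eq hN i x hη).symm

theorem rieszTransformExistsAt (hf : MemL N f) (hN : 1 ≤ N) (i : Fin d)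
    (x : EuclideanSpace ℝ (Fin d)) : RieszTransformExistsAt i f x :=
  ⟨fun _ hη => hf.integrableOn_mul_rieszKernel hN i x hη, _, hf.tendsto_truncatedRiesz hN i x⟩

theorem rieszTransform_eq (hf : MemL N f) (hN : 1 ≤ N) (i : Fin d)
    (x : EuclideanSpace ℝ (Fin d)) :
    rieszTransform i f x =
      rieszConst d * (2⁻¹ * ∫ z, rieszKernel i z * (f (x - z) - f (x + z))) :=
  (hf.tendsto_truncatedRiesz hN i x).limUnder_eq

/-- The Riesz transform commutes with dilations. -/
theorem rieszTransform_comp_smul (hf : MemL N f) (hN : 1 ≤ N) (i : Fin d) {R : ℝ} (hR : 1 ≤ R)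
    (x : EuclideanSpace ℝ (Fin d)) :
    rieszTransform i (fun x => f (R • x)) x = rieszTransform i f (R • x) := by
  have hR0 : 0 < R := by linarith
  rw [(hf.comp_smul hN hR).rieszTransform_eq hN, hf.rieszTransform_eq hN]
  have h : ∀ z, rieszKernel i z * (f (R • (x - z)) - f (R • (x + z))) =
      R ^ d * (rieszKernel i (R • z) * (f (R • x - R • z) - f (R • x + R • z))) := by
    intro z
    rw [rieszKernel_smul i hR0, smul_sub, smul_add]
    field_simp
  simp_rw [h]
  rw [integral_const_mul, Measure.integral_comp_smul volume
    (fun z => rieszKernel i z * (f (R • x - z) - f (R • x + z))),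
    finrank_euclideanSpace, Fintype.card_fin, abs_of_pos (by positivity), smul_eq_mul,
    mul_inv_cancel_left₀ (by positivity)]

/-- The decomposition of the Riesz transform that corresponds to the splitting of the kernel. -/
theorem rieszTransform_eq_near_add_far (hf : MemL N f) (hN : 1 ≤ N) (i : Fin d)
    (x : EuclideanSpace ℝ (Fin d)) :
    rieszTransform i f x = rieszConst d * (2⁻¹ * ∫ z, nearKernel i z * (f (x - z) - f (x + z))) +
      rieszConst d * ∫ y, farKernel i (x - y) * f y := by
  have h1 := hf.integrable_farKernel_mul hN i x
  have h2 := hf.integrable_farKernel_mul_add hN i x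
  have h3 : ∫ y, farKernel i (x - y) * f y = ∫ z, farKernel i z * f (x - z) := by
    rw [← integral_sub_left_eq_self (fun z => farKernel i z * f (x - z)) volume x]
    simp
  have h4 : ∀ z, rieszKernel i z * (f (x - z) - f (x + z)) =
      nearKernel i z * (f (x - z) - f (x + z)) +
        (farKernel i z * f (x - z) - farKernel i z * f (x + z)) := by
    intro z
    rw [← nearKernel_add_farKernel]
    ring
  rw [hf.rieszTransform_eq hN, h3]
  simp_rw [h4]
  rw [integral_add (hf.integrable_nearKernel_mul i x) (by exact h1.sub h2), integral_sub h1 h2,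
    integral_farKernel_mul_add]
  ring

end MemL

/-! ### Moments of the two parts of the Riesz transform -/

namespace MemL

variable {d N : ℕ} {f : EuclideanSpace ℝ (Fin d) → ℝ}

/-- The near part has vanishing moments: by Fubini they are averages of moments of differences of
translates of `f`. -/
theorem integral_monomialFn_mul_near (hf : MemL N f) (i : Fin d) {β : Fin d → ℕ}
    (hβ : ∑ k, β k < N) :
    Integrable (fun x => monomialFn β x * ∫ z, nearKernel i z * (f (x - z) - f (x + z))) ∧
      ∫ x, monomialFn β x * ∫ z, nearKernel i z * (f (x - z) - f (x + z)) = 0 := by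
  obtain ⟨C, ε, hC, hε, hb⟩ := hf.exists_abs_sub_le
  have hcont := hf.differentiable.continuous
  have hmeas := measurable_nearKernel i
  have hmon := continuous_monomialFn β
  set F : EuclideanSpace ℝ (Fin d) × EuclideanSpace ℝ (Fin d) → ℝ :=
    fun p => monomialFn β p.1 * (nearKernel i p.2 * (f (p.1 - p.2) - f (p.1 + p.2))) with hF
  have hFi : Integrable F (volume.prod volume) := by
    have h1 := (integrable_one_add_norm (E := EuclideanSpace ℝ (Fin d)) (μ := volume)
      (r := d + (2 - ε)) (by simp; linarith)).const_mul C
    refine (h1.mul_prod (integrable_norm_mul_nearKernel i)).mono' ?_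
      (Eventually.of_forall fun p => ?_)
    · have h2 : Measurable fun p : EuclideanSpace ℝ (Fin d) × EuclideanSpace ℝ (Fin d) =>
          monomialFn β p.1 := (hmon.comp continuous_fst).measurable
      have h3 : Measurable fun p : EuclideanSpace ℝ (Fin d) × EuclideanSpace ℝ (Fin d) =>
          f (p.1 - p.2) - f (p.1 + p.2) :=
        (by fun_prop : Continuous fun p : EuclideanSpace ℝ (Fin d) × EuclideanSpace ℝ (Fin d) =>
          f (p.1 - p.2) - f (p.1 + p.2)).measurable
      exact (h2.mul ((hmeas.comp measurable_snd).mul h3)).aestronglyMeasurable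
    · obtain ⟨x, z⟩ := p
      simp only [hF, norm_mul, Real.norm_eq_abs]
      rcases le_or_gt 2 ‖z‖ with hz | hz
      · simp [nearKernel_eq_zero i hz]
      calc |monomialFn β x| * (|nearKernel i z| * |f (x - z) - f (x + z)|)
          ≤ (1 + ‖x‖) ^ (N - 1) * (|nearKernel i z| *
              (C * ‖z‖ * (1 + ‖x‖) ^ (-(d : ℝ) - N - 1 + ε))) := by
            gcongr
            · exact abs_monomialFn_le (by omega) x
            · exact hb x z hz.le
        _ = C * ((1 + ‖x‖) ^ (N - 1) * (1 + ‖x‖) ^ (-(d : ℝ) - N - 1 + ε)) *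
              (‖z‖ * |nearKernel i z|) := by ring
        _ = _ := by
            rw [← Real.rpow_natCast, ← Real.rpow_add (by positivity)]
            congr 3
            push_cast [show 1 ≤ N by omega]
            ring
  simp only [← integral_const_mul]
  refine ⟨hFi.integral_prod_left, ?_⟩
  rw [integral_integral_swap (f := fun x z =>
    monomialFn β x * (nearKernel i z * (f (x - z) - f (x + z)))) hFi]
  refine integral_eq_zero_of_ae (Eventually.of_forall fun z => ?_)
  obtain ⟨h1, h2⟩ := hf.integral_monomialFn_mul_sub hβ z
  obtain ⟨h3, h4⟩ := hf.integral_monomialFn_mul_sub hβ (-z)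
  simp only [sub_neg_eq_add] at h3 h4
  have h5 : ∀ x, monomialFn β x * (nearKernel i z * (f (x - z) - f (x + z))) =
      nearKernel i z * (monomialFn β x * f (x - z) - monomialFn β x * f (x + z)) :=
    fun x => by ring
  simp_rw [h5]
  rw [integral_const_mul, integral_sub h1 h3, h2, h4]
  simp

/-- Against `f` the far kernel can be replaced by its Taylor error, which yields a bound for the
weighted `L¹` norm of the far part by a weighted `L¹` norm of `f` of a slightly larger homogeneity
than `N - 1`. -/
theorem exists_integral_far_le (i : Fin d) (n : ℕ) {δ : ℝ} (hδ : 0 < δ) (hδ1 : δ ≤ 1) :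
    ∃ M : ℝ, ∀ f : EuclideanSpace ℝ (Fin d) → ℝ, MemL (n + 1) f →
      Integrable (fun y => ‖y‖ ^ (n + δ) * |f y|) →
      ∀ β : Fin d → ℕ, ∑ k, β k ≤ n →
        Integrable (fun x => monomialFn β x * ∫ y, farKernel i (x - y) * f y) ∧
        |∫ x, monomialFn β x * ∫ y, farKernel i (x - y) * f y| ≤
          M * ∫ y, ‖y‖ ^ (n + δ) * |f y| := by
  obtain ⟨C, hC, hb⟩ := exists_abs_farKernel_sub_taylorSub_le i n hδ hδ1
  set w : EuclideanSpace ℝ (Fin d) → ℝ := fun x => (1 + ‖x‖) ^ (-((d : ℝ) + δ)) with hw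
  have hwi : Integrable w := integrable_one_add_norm (by simpa using hδ)
  refine ⟨C * (2 * ∫ x, w x), fun f hf hfi β hβ => ?_⟩
  set h : EuclideanSpace ℝ (Fin d) → ℝ := fun y => ‖y‖ ^ (n + δ) * |f y| with hh
  have hcont := hf.differentiable.continuous
  have hmon := continuous_monomialFn β
  have hfar := (contDiff_farKernel i 0).continuous
  have htay := continuous_taylorSub (n + 1) (contDiff_farKernel i)
  set F : EuclideanSpace ℝ (Fin d) × EuclideanSpace ℝ (Fin d) → ℝ := fun p => monomialFn β p.1 *
    ((farKernel i (p.1 - p.2) - taylorSub (n + 1) (farKernel i) p.1 p.2) * f p.2) with hF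
  set G₁ : EuclideanSpace ℝ (Fin d) × EuclideanSpace ℝ (Fin d) → ℝ := fun p => w p.1 * h p.2
    with hG₁
  set G₂ : EuclideanSpace ℝ (Fin d) × EuclideanSpace ℝ (Fin d) → ℝ := fun p => h p.2 * w (p.1 - p.2)
    with hG₂
  have hG₁i : Integrable G₁ (volume.prod volume) := hwi.mul_prod hfi
  have hG₂i : Integrable G₂ (volume.prod volume) :=
    hfi.convolution_integrand (ContinuousLinearMap.mul ℝ ℝ) hwi
  have hG₁int : ∫ p, G₁ p ∂(volume.prod volume) = (∫ x, w x) * ∫ y, h y := integral_prod_mul w h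
  have hG₂int : ∫ p, G₂ p ∂(volume.prod volume) = (∫ x, w x) * ∫ y, h y := by
    rw [integral_prod_symm _ hG₂i]
    simp only [hG₂, integral_const_mul, integral_sub_right_eq_self w, integral_mul_const]
    ring
  have hFG : ∀ p, ‖F p‖ ≤ C * (G₁ p + G₂ p) := by
    rintro ⟨x, y⟩
    simp only [hF, norm_mul, Real.norm_eq_abs]
    calc _ ≤ (1 + ‖x‖) ^ n *
          (|farKernel i (x - y) - taylorSub (n + 1) (farKernel i) x y| * |f y|) := by
          gcongr
          exact abs_monomialFn_le hβ x
      _ = ((1 + ‖x‖) ^ n * |farKernel i (x - y) - taylorSub (n + 1) (farKernel i) x y|) *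
            |f y| := by ring
      _ ≤ (C * ‖y‖ ^ (n + δ) * (w x + w (x - y))) * |f y| :=
          mul_le_mul_of_nonneg_right (hb x y) (abs_nonneg _)
      _ = _ := by simp only [hG₁, hG₂, hh]; ring
  have hFi : Integrable F (volume.prod volume) := by
    refine ((hG₁i.add hG₂i).const_mul C).mono' ?_ (Eventually.of_forall hFG)
    exact Continuous.aestronglyMeasurable (by fun_prop)
  have hinner : ∀ x, monomialFn β x * ∫ y, farKernel i (x - y) * f y = ∫ y, F (x, y) := by
    intro x
    obtain ⟨h1, h2⟩ := hf.integral_taylorSub_mul (farKernel i) x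
    have h3 : Integrable fun y => farKernel i (x - y) * f y := by
      simpa using (hf.integrable_farKernel_mul (by omega) i x).comp_sub_left x
    simp only [hF, integral_const_mul, sub_mul]
    rw [integral_sub h3 h1, h2, sub_zero]
  simp_rw [hinner]
  refine ⟨hFi.integral_prod_left, ?_⟩
  rw [← integral_prod _ hFi]
  calc |∫ p, F p ∂(volume.prod volume)| ≤ ∫ p, C * (G₁ p + G₂ p) ∂(volume.prod volume) :=
        norm_integral_le_of_norm_le ((hG₁i.add hG₂i).const_mul C) (Eventually.of_forall hFG)
    _ = _ := by
        rw [integral_const_mul, integral_add hG₁i hG₂i, hG₁int, hG₂int]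
        ring

/-- The bound of the moments of the Riesz transform on the class `L_N` behind the dilation
argument. -/
theorem exists_integral_rieszTransform_le (i : Fin d) (n : ℕ) {δ : ℝ} (hδ : 0 < δ) (hδ1 : δ ≤ 1) :
    ∃ M : ℝ, ∀ f : EuclideanSpace ℝ (Fin d) → ℝ, MemL (n + 1) f →
      Integrable (fun y => ‖y‖ ^ (n + δ) * |f y|) →
      ∀ β : Fin d → ℕ, ∑ k, β k ≤ n →
        Integrable (fun x => monomialFn β x * rieszTransform i f x) ∧
        |∫ x, monomialFn β x * rieszTransform i f x| ≤ M * ∫ y, ‖y‖ ^ (n + δ) * |f y| := by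
  obtain ⟨M, hM⟩ := exists_integral_far_le i n hδ hδ1
  refine ⟨|rieszConst d| * M, fun f hf hfi β hβ => ?_⟩
  obtain ⟨h1, h2⟩ := hf.integral_monomialFn_mul_near i (Nat.lt_succ_of_le hβ)
  obtain ⟨h3, h4⟩ := hM f hf hfi β hβ
  have h5 : ∀ x, monomialFn β x * rieszTransform i f x =
      rieszConst d * 2⁻¹ * (monomialFn β x * ∫ z, nearKernel i z * (f (x - z) - f (x + z))) +
        rieszConst d * (monomialFn β x * ∫ y, farKernel i (x - y) * f y) := by
    intro x
    rw [hf.rieszTransform_eq_near_add_far (by omega)]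
    ring
  simp_rw [h5]
  refine ⟨(h1.const_mul _).add (h3.const_mul _), ?_⟩
  rw [integral_add (h1.const_mul _) (h3.const_mul _), integral_const_mul, integral_const_mul, h2,
    mul_zero, zero_add, abs_mul, mul_assoc]
  gcongr

end MemL

/-! ### Vanishing of the moments by dilation -/

theorem theorem3p4 {d : ℕ} (N : ℕ) (hN : 1 ≤ N) (f : EuclideanSpace ℝ (Fin d) → ℝ)
    (hf : MemL N f) (i : Fin d) :
    (∀ x, RieszTransformExistsAt i f x) ∧ HasVanishingMoments N (rieszTransform i f) := by
  refine ⟨hf.rieszTransformExistsAt hN i, fun β hβ => ?_⟩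
  obtain ⟨n, rfl⟩ : ∃ n, N = n + 1 := ⟨N - 1, by omega⟩
  have hβn : ∑ k, β k ≤ n := Nat.lt_succ_iff.1 hβ
  have hcont := hf.differentiable.continuous
  obtain ⟨δ, hδ, hδ1, hint⟩ := hf.exists_integrable_rpow
  have hfi : Integrable fun y => ‖y‖ ^ (n + δ) * |f y| := by
    have hc : Continuous fun y : EuclideanSpace ℝ (Fin d) => ‖y‖ ^ (n + δ) :=
      continuous_norm.rpow_const fun _ => Or.inr (by positivity)
    refine hint.mono' (hc.mul hcont.abs).aestronglyMeasurable (Eventually.of_forall fun y => ?_)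
    rw [Real.norm_eq_abs, abs_of_nonneg (by positivity),
      show ((n + 1 : ℕ) : ℝ) - 1 + δ = n + δ by push_cast; ring]
    gcongr
    linarith
  obtain ⟨M, hM⟩ := MemL.exists_integral_rieszTransform_le i n hδ hδ1
  refine ⟨(hM f hf hfi β hβn).1, ?_⟩
  set I := ∫ x, monomialFn β x * rieszTransform i f x with hI
  set J := ∫ y, ‖y‖ ^ (n + δ) * |f y| with hJ
  set m := ∑ k, β k with hm
  -- the bound for the dilated function `x ↦ f (R • x)`
  have hbound : ∀ R : ℝ, 1 ≤ R → |I| ≤ M * J * R ^ (-δ) := by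
    intro R hR
    have hR0 : 0 < R := by linarith
    have h1 : ∀ y, ‖y‖ ^ (n + δ) * |f (R • y)| =
        (R ^ (n + δ))⁻¹ * (‖R • y‖ ^ (n + δ) * |f (R • y)|) := by
      intro y
      rw [norm_smul, Real.norm_eq_abs, abs_of_pos hR0, Real.mul_rpow hR0.le (norm_nonneg y)]
      field_simp
    have h2 : ∀ x, monomialFn β x * rieszTransform i (fun x => f (R • x)) x =
        (R ^ m)⁻¹ * (monomialFn β (R • x) * rieszTransform i f (R • x)) := by
      intro x
      rw [hf.rieszTransform_comp_smul hN i hR, monomialFn_smul, ← hm]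
      field_simp
    have h3 : Integrable fun y => ‖y‖ ^ (n + δ) * |f (R • y)| := by
      simp_rw [h1]
      exact (hfi.comp_smul hR0.ne').const_mul _
    have h4 := (hM _ (hf.comp_smul hN hR) h3 β hβn).2
    simp_rw [h1, h2] at h4
    rw [integral_const_mul, integral_const_mul, Measure.integral_comp_smul volume
      (fun x => monomialFn β x * rieszTransform i f x), Measure.integral_comp_smul volume
      (fun y => ‖y‖ ^ (n + δ) * |f y|), ← hI, ← hJ, smul_eq_mul, smul_eq_mul, abs_mul, abs_mul,
      abs_abs, abs_of_pos (by positivity : 0 < (R ^ m)⁻¹), finrank_euclideanSpace, Fintype.card_fin,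
      abs_of_pos (by positivity : 0 < (R ^ d)⁻¹)] at h4
    have hMJ : 0 ≤ M * J := (abs_nonneg _).trans (hM f hf hfi β hβn).2
    have h5 : |I| ≤ M * J * (R ^ m * (R ^ (n + δ))⁻¹) := by
      have h6 : |I| = R ^ m * R ^ d * ((R ^ m)⁻¹ * ((R ^ d)⁻¹ * |I|)) := by field_simp
      rw [h6]
      calc _ ≤ R ^ m * R ^ d * (M * ((R ^ (n + δ))⁻¹ * ((R ^ d)⁻¹ * J))) := by gcongr
        _ = _ := by field_simp
    refine h5.trans ?_
    gcongr
    rw [← Real.rpow_natCast, ← Real.rpow_neg hR0.le, ← Real.rpow_add hR0]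
    have : (m : ℝ) ≤ n := by exact_mod_cast hβn
    gcongr
    linarith
  have hlim : Tendsto (fun R : ℝ => M * J * R ^ (-δ)) atTop (𝓝 (M * J * 0)) :=
    (tendsto_rpow_neg_atTop hδ).const_mul _
  rw [mul_zero] at hlim
  have h0 : |I| ≤ 0 := ge_of_tendsto hlim (by
    filter_upwards [eventually_ge_atTop 1] with R hR using hbound R hR)
  exact abs_nonpos_iff.1 h0
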